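/- Let $f:\mathbb{R}^n\to\mathbb{R}$ and $g:\mathbb{R}^n\to\mathbb{R}^m$ be twice continuously differentiable, let $K\subseteq\mathbb{R}^m$ be closed, and put $C:=g^{-1}(K)$ and $L(x,\lambda):=f(x)+\langle\lambda,g(x)\rangle$. For a set $S$ in a Euclidean space, a point $y$ and a direction $v$, define: - the tangent cone $T_S(y):=\{v \mid \exists\, t_k\downarrow 0,\ v_k\to v:\ y+t_kv_k\in S\}$; - the second-order tangent set $T^2_S(y;v):=\{w\mid \exists\, t_k\downarrow0,\ w_k\to w:\ y+t_kv+\tfrac12t_k^2w_k\in S\}$; - the asymptotic second-order tangent cone $T''_S(y;v):=\{w\mid \exists\, t_k\downarrow 0,\ r_k\downarrow0,\ w_k\to w:\ t_k/r_k\to0,\ y+t_kv+\tfrac12t_kr_kw_k\in S\}$; - the Fréchet normal cone $\hat N_S(y):=\{\eta\mid \limsup_{y'\to y,\,y'\in S}\langle\eta,y'-y\rangle/\|y'-y\|\le0\}$ if $y\in S$, and $\hat N_S(y):=\emptyset$ if $y\notin S$; - the directional limiting normal cone $N_S(y;v):=\{\eta\mid\exists\, t_k\downarrow0,\ v_k\to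 v,\ \eta_k\to\eta:\ \eta_k\in\hat N_S(y+t_kv_k)\}$; - the support function $\sigma_S(\lambda):=\sup_{u\in S}\langle\lambda,u\rangle\in[-\infty,+\infty]$. Let $\bar x\in C$ and $d\in T_C(\bar x)$ with $\nabla f(\bar x)d=0$. Suppose that $\bar x$ is a local minimizer of $f$ over $C$ in direction $d$, that is, there are $\rho,\delta>0$ such that $f(x)\ge f(\bar x)$ for every $x\in C$ for which $w:=x-\bar x$ satisfies $\|w\|\le\delta$ and $\big\|\,\|d\|w-\|w\|d\,\big\|\le\rho\|w\|\|d\|$. Suppose also that the directional nondegeneracy condition holds: $$\nabla g(\bar x)^T\lambda=0,\quad \lambda\in\operatorname{span}N_K(g(\bar x);\nabla g(\bar x)d)\quad\Longrightarrow\quad\lambda=0.$$ Then there is exactly one $\lambda\in\mathbb{R}^m$ with $\lambda\in N_K(g(\bar x);\nabla g(\bar x)d)$ and $\nabla_xL(\bar x,\lambda)=0$; that is, the set $\Lambda(\bar x;d)$ of all such multipliers is a singleton $\{\lambda\}$. This $\lambda$ satisfies: 1. $\sigma_{T''_K(g(\bar x);\nabla g(\bar x)d)}(\lambda)\le0$;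 2. if $T^2_K(g(\bar x);\nabla g(\bar x)d)\neq\emptyset$, then $\nabla^2_{xx}L(\bar x,\lambda)(d,d)-\sigma_{T^2_K(g(\bar x);\nabla g(\bar x)d)}(\lambda)\ge0$. -/

import Mathlib

open Set Filter Topology

noncomputable section

namespace DirOpt

/-- The Bouligand (contingent) tangent cone `T_S(x)`. -/
def tangentCone {E : Type*} [NormedAddCommGroup E] [InnerProductSpace ℝ E]
    (S : Set E) (x : E) : Set E :=
  {d | ∃ (t : ℕ → ℝ) (d' : ℕ → E), (∀ k, 0 < t k) ∧ Tendsto t atTop (𝓝 0) ∧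
    Tendsto d' atTop (𝓝 d) ∧ ∀ k, x + t k • d' k ∈ S}

/-- The (outer) second-order tangent set `T²_S(x; d)`. -/
def secondTangentSet {E : Type*} [NormedAddCommGroup E] [InnerProductSpace ℝ E]
    (S : Set E) (x d : E) : Set E :=
  {w | ∃ (t : ℕ → ℝ) (w' : ℕ → E), (∀ k, 0 < t k) ∧ Tendsto t atTop (𝓝 0) ∧
    Tendsto w' atTop (𝓝 w) ∧ ∀ k, x + t k • d + ((1 / 2 : ℝ) * t k ^ 2) • w' k ∈ S}

/-- The asymptotic second-order tangent cone `T''_S(x; d)`. -/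
def asympSecondTangentCone {E : Type*} [NormedAddCommGroup E] [InnerProductSpace ℝ E]
    (S : Set E) (x d : E) : Set E :=
  {w | ∃ (t r : ℕ → ℝ) (w' : ℕ → E), (∀ k, 0 < t k) ∧ (∀ k, 0 < r k) ∧
    Tendsto t atTop (𝓝 0) ∧ Tendsto r atTop (𝓝 0) ∧
    Tendsto (fun k => t k / r k) atTop (𝓝 0) ∧ Tendsto w' atTop (𝓝 w) ∧
    ∀ k, x + t k • d + ((1 / 2 : ℝ) * (t k * r k)) • w' k ∈ S}

/-- The Fréchet (regular) normal cone to `S` at `x`; it is empty when `x ∉ S`.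
The condition is `limsup ⟨v, y - x⟩ / ‖y - x‖ ≤ 0` as `y → x` within `S`. -/
def frechetNormalCone {E : Type*} [NormedAddCommGroup E] [InnerProductSpace ℝ E]
    (S : Set E) (x : E) : Set E :=
  {v | x ∈ S ∧ ∀ ε : ℝ, 0 < ε → ∀ᶠ y in 𝓝[S] x, inner ℝ v (y - x) ≤ ε * ‖y - x‖}

/-- The limiting normal cone `N_S(x; d)` to `S` at `x` in direction `d`: the outer limit of
the Fréchet normal cones at `x + t d'` as `t ↓ 0` and `d' → d`. -/
def dirNormalCone {E : Type*} [NormedAddCommGroup E] [InnerProductSpace ℝ E]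
    (S : Set E) (x d : E) : Set E :=
  {v | ∃ (t : ℕ → ℝ) (d' v' : ℕ → E), (∀ k, 0 < t k) ∧ Tendsto t atTop (𝓝 0) ∧
    Tendsto d' atTop (𝓝 d) ∧ Tendsto v' atTop (𝓝 v) ∧
    ∀ k, v' k ∈ frechetNormalCone S (x + t k • d' k)}

/-- The directional neighborhood `V_{ρ,δ}(d)`. -/
def dirNhd {E : Type*} [NormedAddCommGroup E] [InnerProductSpace ℝ E]
    (ρ δ : ℝ) (d : E) : Set E :=
  {w | ‖w‖ ≤ δ ∧ ‖‖d‖ • w - ‖w‖ • d‖ ≤ ρ * ‖w‖ * ‖d‖}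

/-- `x` is a local minimizer of `f` over `C` in direction `d`. -/
def IsDirLocalMin {E : Type*} [NormedAddCommGroup E] [InnerProductSpace ℝ E]
    (f : E → ℝ) (C : Set E) (x d : E) : Prop :=
  x ∈ C ∧ ∃ ρ δ : ℝ, 0 < ρ ∧ 0 < δ ∧ ∀ y ∈ C, y - x ∈ dirNhd ρ δ d → f x ≤ f y

/-- The support function `σ_S`, with values in `[-∞, ∞]` and `σ_∅ = -∞`. -/
def supportFn {E : Type*} [NormedAddCommGroup E] [InnerProductSpace ℝ E]
    (S : Set E) (l : E) : EReal :=
  ⨆ u ∈ S, ((inner ℝ l u : ℝ) : EReal)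

/-- The Lagrangian `L(x, l) = f(x) + ⟨l, g(x)⟩`. -/
def lagrangian {n m : ℕ} (f : EuclideanSpace ℝ (Fin n) → ℝ)
    (g : EuclideanSpace ℝ (Fin n) → EuclideanSpace ℝ (Fin m))
    (x : EuclideanSpace ℝ (Fin n)) (l : EuclideanSpace ℝ (Fin m)) : ℝ :=
  f x + inner ℝ l (g x)

/-- The second derivative `∇²_{xx} L(x, l)(d, d)` of the Lagrangian in `x`. -/
def lagrangianHess {n m : ℕ} (f : EuclideanSpace ℝ (Fin n) → ℝ)
    (g : EuclideanSpace ℝ (Fin n) → EuclideanSpace ℝ (Fin m))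
    (x : EuclideanSpace ℝ (Fin n)) (l : EuclideanSpace ℝ (Fin m))
    (d : EuclideanSpace ℝ (Fin n)) : ℝ :=
  fderiv ℝ (fderiv ℝ (fun y => lagrangian f g y l)) x d d

/-- The set `Λ(x; d)` of M-multipliers in direction `d`. -/
def multiplierSet {n m : ℕ} (f : EuclideanSpace ℝ (Fin n) → ℝ)
    (g : EuclideanSpace ℝ (Fin n) → EuclideanSpace ℝ (Fin m))
    (K : Set (EuclideanSpace ℝ (Fin m))) (x d : EuclideanSpace ℝ (Fin n)) :
    Set (EuclideanSpace ℝ (Fin m)) :=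
  {l | l ∈ dirNormalCone K (g x) (fderiv ℝ g x d) ∧
    gradient (fun y => lagrangian f g y l) x = 0}

/-- The directional nondegeneracy condition for the constraint `g(x) ∈ K`. -/
def DirNondegenerate {n m : ℕ}
    (g : EuclideanSpace ℝ (Fin n) → EuclideanSpace ℝ (Fin m))
    (K : Set (EuclideanSpace ℝ (Fin m))) (x d : EuclideanSpace ℝ (Fin n)) : Prop :=
  ∀ l : EuclideanSpace ℝ (Fin m), ContinuousLinearMap.adjoint (fderiv ℝ g x) l = 0 →
    l ∈ Submodule.span ℝ (dirNormalCone K (g x) (fderiv ℝ g x d)) → l = 0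

end DirOpt

end

namespace DirOpt

/-! Write `A` for the derivative of `g` at `x`, `N` for the normal cone to `K` in direction `A d`,
and `W` for its span. Nondegeneracy says that `ker A* ∩ W = 0`. It is used in three ways.

As `N ⊆ W`, no nonzero element of `N` is killed by `A*`. By compactness `‖A* η‖` is bounded below on
unit Fréchet normals at points near `g x` in direction `A d`. This bounds the multipliers of
penalized problems, so a limit exists (`exists_multiplier`); it also gives metric regularity of the
constraint along `d` (`exists_preimage_near`). Two multipliers differ by an element of `ker A* ∩ W`,
whence uniqueness.

Dually, `range A + Wᗮ` is the whole space. For a second-order tangent `w`, with scale `s` and `t² /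
(2 s) → β`, write `w - β ∇²g(d,d) = A u + z` with `z ∈ Wᗮ`. Then `g (x + t d + s u)` agrees up to
`o(s)` with a point of `K` translated by `-s z`. Since `z` is orthogonal to all directional normals,
`K` is invariant under this translation up to `o(s)` (`exists_mem_near_translate`). Metric
regularity now gives feasible points at distance `o(s)` from `x + t d + s u`, where `f` is at least
`f x`. Expanding the Lagrangian, with `⟨l, z⟩ = 0`, yields `⟨l, w⟩ ≤ β ∇²L(d,d)`
(`inner_le_of_second_order_tangent`). The two claims are the cases `β = 0` and `β = 1`. -/

/-! ### Fréchet normals and directional limiting normals. -/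

theorem smul_mem_frechetNormalCone {Y : Type*} [NormedAddCommGroup Y] [InnerProductSpace ℝ Y]
    {K : Set Y} {p η : Y} (h : η ∈ frechetNormalCone K p) {c : ℝ} (hc : 0 ≤ c) :
    c • η ∈ frechetNormalCone K p := by
  refine ⟨h.1, fun ε hε => ?_⟩
  filter_upwards [h.2 (ε / (c + 1)) (by positivity)] with y hy
  rw [real_inner_smul_left]
  calc c * inner ℝ η (y - p) ≤ c * (ε / (c + 1) * ‖y - p‖) := by gcongr
    _ = (c / (c + 1)) * (ε * ‖y - p‖) := by ring
    _ ≤ 1 * (ε * ‖y - p‖) := by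
        gcongr
        rw [div_le_one (by positivity)]
        linarith
    _ = ε * ‖y - p‖ := one_mul _

/-- Squaring `‖q - p‖ ≤ ‖q - y‖` gives `2 ⟨q - p, y - p⟩ ≤ ‖y - p‖²`, which is of second order in `y
- p`. -/
theorem sub_mem_frechetNormalCone_of_infDist_eq {Y : Type*} [NormedAddCommGroup Y]
    [InnerProductSpace ℝ Y] {K : Set Y} {p q : Y} (hp : p ∈ K)
    (h : Metric.infDist q K = ‖q - p‖) : q - p ∈ frechetNormalCone K p := by
  refine ⟨hp, fun ε hε => ?_⟩
  have hball : ∀ᶠ y in 𝓝[K] p, y ∈ Metric.ball p ε :=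
    mem_nhdsWithin_of_mem_nhds (Metric.ball_mem_nhds p hε)
  filter_upwards [hball, self_mem_nhdsWithin] with y hy hyK
  have h1 : ‖q - p‖ ≤ ‖(q - p) - (y - p)‖ := by
    have := Metric.infDist_le_dist_of_mem (x := q) hyK
    rwa [h, dist_eq_norm, ← sub_sub_sub_cancel_right q y p] at this
  have h2 := norm_sub_sq_real (q - p) (y - p)
  have h3 : ‖q - p‖ ^ 2 ≤ ‖(q - p) - (y - p)‖ ^ 2 := by gcongr
  rw [Metric.mem_ball, dist_eq_norm] at hy
  nlinarith [norm_nonneg (y - p)]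

/-- Later estimates describe nearness in a direction by tubes `‖p - y - t v‖ ≤ θ t` with `t ≤ θ`;
this lemma turns them back into the sequential definition. -/
theorem mem_dirNormalCone_of_seq {Y : Type*} [NormedAddCommGroup Y] [InnerProductSpace ℝ Y]
    {K : Set Y} {y v η : Y} {θ t : ℕ → ℝ} {p e : ℕ → Y} (hθ : Tendsto θ atTop (𝓝 0))
    (ht : ∀ k, 0 < t k) (htθ : ∀ k, t k ≤ θ k) (hp : ∀ k, ‖p k - y - t k • v‖ ≤ θ k * t k)
    (he : Tendsto e atTop (𝓝 η)) (hmem : ∀ k, e k ∈ frechetNormalCone K (p k)) :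
    η ∈ dirNormalCone K y v := by
  refine ⟨t, fun k => (t k)⁻¹ • (p k - y), e, ht,
    squeeze_zero (fun k => (ht k).le) htθ hθ, ?_, he, fun k => ?_⟩
  · rw [tendsto_iff_norm_sub_tendsto_zero]
    refine squeeze_zero (fun k => norm_nonneg _) (fun k => ?_) hθ
    have h1 : (t k)⁻¹ • (p k - y) - v = (t k)⁻¹ • (p k - y - t k • v) := by
      rw [smul_sub (t k)⁻¹ (p k - y), smul_smul, inv_mul_cancel₀ (ht k).ne', one_smul]
    rw [h1, norm_smul, norm_inv, Real.norm_of_nonneg (ht k).le, inv_mul_le_iff₀ (ht k), mul_comm]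
    exact hp k
  · rw [smul_smul, mul_inv_cancel₀ (ht k).ne', one_smul, add_sub_cancel]
    exact hmem k

/-- A continuous function that is positive on the unit vectors of the directional normal cone is
bounded away from zero on the unit Fréchet normals at points near the base point in the given
direction. -/
theorem exists_forall_frechetNormalCone_lt {Y : Type*} [NormedAddCommGroup Y]
    [InnerProductSpace ℝ Y] [FiniteDimensional ℝ Y] {K : Set Y} {y v : Y} {F : Y → ℝ}
    (hF : Continuous F) (hpos : ∀ η ∈ dirNormalCone K y v, ‖η‖ = 1 → 0 < F η) :
    ∃ θ : ℝ, 0 < θ ∧ ∀ t, 0 < t → t ≤ θ → ∀ p, ‖p - y - t • v‖ ≤ θ * t →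
      ∀ η ∈ frechetNormalCone K p, ‖η‖ = 1 → θ < F η := by
  -- Failure for every `θ = 1 / (k + 1)` produces unit Fréchet normals whose cluster point is a unit
  -- directional normal with `F ≤ 0`.
  by_contra! hcon
  choose t ht htθ p hp e he hnorm hFe using fun k : ℕ =>
    hcon (1 / ((k : ℝ) + 1)) Nat.one_div_pos_of_nat
  obtain ⟨η, hη, φ, hφ, hlim⟩ := (isCompact_sphere (0 : Y) 1).tendsto_subseq
    (x := e) (fun k => by simpa using hnorm k)
  have hθ : Tendsto (fun k => 1 / (((φ k : ℕ) : ℝ) + 1)) atTop (𝓝 0) :=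
    (tendsto_one_div_add_atTop_nhds_zero_nat (𝕜 := ℝ)).comp hφ.tendsto_atTop
  have hmem : η ∈ dirNormalCone K y v :=
    mem_dirNormalCone_of_seq hθ (fun k => ht (φ k)) (fun k => htθ (φ k)) (fun k => hp (φ k))
      hlim (fun k => he (φ k))
  have h0 : F η ≤ 0 := le_of_tendsto_of_tendsto ((hF.tendsto η).comp hlim) hθ
    (Eventually.of_forall fun k => hFe (φ k))
  exact absurd (hpos η hmem (by simpa using hη)) (not_lt.mpr h0)

/-! ### Local estimates along a direction. -/

/-- A function differentiable at `x` follows its derivative along points near `x` in direction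
`d`. -/
theorem exists_forall_near_image {E Y : Type*} [NormedAddCommGroup E] [NormedSpace ℝ E]
    [NormedAddCommGroup Y] [NormedSpace ℝ Y] {g : E → Y} {A : E →L[ℝ] Y} {x : E}
    (hg : HasFDerivAt g A x) (d : E) {θ : ℝ} (hθ : 0 < θ) :
    ∃ τ : ℝ, 0 < τ ∧ ∀ t, 0 < t → t ≤ τ → ∀ q, ‖q - x - t • d‖ ≤ τ * t →
      ‖g q - g x - t • A d‖ ≤ θ * t := by
  set μ : ℝ := θ / (2 * (‖d‖ + 1)) with hμ
  have hμ0 : 0 < μ := by positivity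
  obtain ⟨r, hr, hball⟩ := Metric.eventually_nhds_iff.mp (hg.isLittleO.bound hμ0)
  set τ : ℝ := min 1 (min (θ / (2 * (‖A‖ + 1))) (r / (2 * (‖d‖ + 1)))) with hτ
  have hτ0 : 0 < τ := by positivity
  have hτ1 : τ ≤ 1 := min_le_left _ _
  have hτ2 : τ ≤ θ / (2 * (‖A‖ + 1)) := (min_le_right _ _).trans (min_le_left _ _)
  have hτ3 : τ ≤ r / (2 * (‖d‖ + 1)) := (min_le_right _ _).trans (min_le_right _ _)
  refine ⟨τ, hτ0, fun t ht htτ q hq => ?_⟩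
  have hqx : ‖q - x‖ ≤ t * (‖d‖ + 1) := by
    calc ‖q - x‖ = ‖(q - x - t • d) + t • d‖ := by rw [sub_add_cancel]
      _ ≤ ‖q - x - t • d‖ + ‖t • d‖ := norm_add_le _ _
      _ ≤ 1 * t + t * ‖d‖ := by
        rw [norm_smul, Real.norm_of_nonneg ht.le]
        gcongr
        exact hq.trans (by gcongr)
      _ = t * (‖d‖ + 1) := by ring
  have hlt : dist q x < r := by
    rw [dist_eq_norm]
    calc ‖q - x‖ ≤ t * (‖d‖ + 1) := hqx
      _ ≤ r / (2 * (‖d‖ + 1)) * (‖d‖ + 1) := by gcongr; exact htτ.trans hτ3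
      _ = r / 2 := by field_simp
      _ < r := by linarith
  have h1 : ‖g q - g x - A (q - x)‖ ≤ θ / 2 * t := by
    calc _ ≤ μ * ‖q - x‖ := hball hlt
      _ ≤ μ * (t * (‖d‖ + 1)) := by gcongr
      _ = θ / 2 * t := by rw [hμ]; field_simp
  have h2 : ‖A (q - x - t • d)‖ ≤ θ / 2 * t := by
    calc _ ≤ ‖A‖ * ‖q - x - t • d‖ := A.le_opNorm _
      _ ≤ (‖A‖ + 1) * (θ / (2 * (‖A‖ + 1)) * t) := by
        gcongr
        · linarith
        · exact hq.trans (by gcongr)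
      _ = θ / 2 * t := by field_simp
  calc ‖g q - g x - t • A d‖ = ‖(g q - g x - A (q - x)) + A (q - x - t • d)‖ := by
        congr 1
        simp only [map_sub, map_smul]
        abel
    _ ≤ _ := norm_add_le _ _
    _ ≤ θ / 2 * t + θ / 2 * t := add_le_add h1 h2
    _ = θ * t := by ring

/-- The Taylor expansion of order two of a twice continuously differentiable function. -/
theorem taylor_two_isLittleO {E G : Type*} [NormedAddCommGroup E] [NormedSpace ℝ E]
    [NormedAddCommGroup G] [NormedSpace ℝ G] {F : E → G} (hF : ContDiff ℝ 2 F) (x : E) :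
    (fun h => F (x + h) - F x - fderiv ℝ F x h - (1 / 2 : ℝ) • fderiv ℝ (fderiv ℝ F) x h h)
      =o[𝓝 0] fun h => ‖h‖ ^ 2 := by
  -- Symmetry collapses the derivative of `B h h` to `2 B h`. The remainder then has derivative
  -- `o(‖h‖)`, and the mean value inequality on a ball makes it `o(‖h‖²)`.
  have hsymm : IsSymmSndFDerivAt ℝ F x :=
    (hF.contDiffAt (x := x)).isSymmSndFDerivAt (by simp)
  have hdiff : Differentiable ℝ F := hF.differentiable (by norm_num)
  have hdiff' : Differentiable ℝ (fderiv ℝ F) :=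
    (hF.fderiv_right (m := 1) (by norm_num)).differentiable (by norm_num)
  set B := fderiv ℝ (fderiv ℝ F) x with hB
  set R : E → G := fun h => F (x + h) - F x - fderiv ℝ F x h - (1 / 2 : ℝ) • B h h with hR
  have hderiv : ∀ h, HasFDerivAt R (fderiv ℝ F (x + h) - fderiv ℝ F x - B h) h := by
    intro h
    have h1 : HasFDerivAt (fun h => F (x + h)) (fderiv ℝ F (x + h)) h := by
      exact (hdiff (x + h)).hasFDerivAt.comp h ((hasFDerivAt_id h).const_add x)
    have h2 : HasFDerivAt (fun h => B h h) (B h + B.flip h) h := by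
      refine (B.hasFDerivAt.clm_apply (hasFDerivAt_id h)).congr_fderiv ?_
      ext k
      simp
    have h3 := ((h1.sub_const (F x)).sub (fderiv ℝ F x).hasFDerivAt).sub
      (h2.const_smul (1 / 2 : ℝ))
    refine h3.congr_fderiv ?_
    ext k
    have h4 : B k h = B h k := hsymm k h
    simp only [sub_apply, smul_apply,
      add_apply, ContinuousLinearMap.flip_apply, h4]
    rw [← two_smul ℝ (B h k), smul_smul]
    norm_num
  rw [Asymptotics.isLittleO_iff]
  intro c hc
  have hlo := (hdiff' x).hasFDerivAt.isLittleO.bound hc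
  obtain ⟨r, hr, hball⟩ := Metric.eventually_nhds_iff.mp hlo
  filter_upwards [Metric.ball_mem_nhds (0 : E) hr] with h hh
  have hh' : ‖h‖ < r := by simpa using hh
  have key := (convex_closedBall (0 : E) ‖h‖).norm_image_sub_le_of_norm_hasFDerivWithin_le
    (f := R) (C := c * ‖h‖) (x := 0) (y := h)
    (fun k _ => (hderiv k).hasFDerivWithinAt) (fun k hk => by
      have hk' : ‖k‖ ≤ ‖h‖ := by simpa using hk
      have := hball (y := x + k) (by simpa using hk'.trans_lt hh')
      rw [add_sub_cancel_left] at this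
      exact this.trans (by gcongr)) (by simp) (by simp)
  have hR0 : R 0 = 0 := by simp [hR]
  rw [hR0, sub_zero, sub_zero] at key
  calc ‖R h‖ ≤ c * ‖h‖ * ‖h‖ := key
    _ = c * ‖‖h‖ ^ 2‖ := by rw [norm_pow, norm_norm]; ring

/-- The identity `‖d‖ w - ‖w‖ d = ‖d‖ (w - t d) + (t ‖d‖ - ‖w‖) d` bounds the angular defect by `2 τ
t ‖d‖`, while `‖w‖ ≥ t (‖d‖ - τ)`. -/
theorem exists_forall_mem_dirNhd {E : Type*} [NormedAddCommGroup E] [InnerProductSpace ℝ E]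
    {ρ δ : ℝ} (hρ : 0 < ρ) (hδ : 0 < δ) (d : E) :
    ∃ τ : ℝ, 0 < τ ∧ ∀ t, 0 < t → t ≤ τ → ∀ w, ‖w - t • d‖ ≤ τ * t → w ∈ dirNhd ρ δ d := by
  obtain ⟨τ, hτ0, hτ1, hτ2, hτ3⟩ : ∃ τ : ℝ, 0 < τ ∧ τ ≤ 1 ∧ τ * (‖d‖ + 1) ≤ δ ∧
      (d ≠ 0 → 2 * τ ≤ ρ * (‖d‖ - τ)) := by
    have hpos : 0 < δ / (‖d‖ + 1) := by positivity
    rcases eq_or_ne d 0 with rfl | h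
    · refine ⟨min 1 (δ / (‖(0 : E)‖ + 1)), by positivity, min_le_left _ _, ?_, by simp⟩
      rw [← le_div_iff₀ (by positivity)]
      exact min_le_right _ _
    · have h0 := norm_pos_iff.mpr h
      refine ⟨min 1 (min (δ / (‖d‖ + 1)) (ρ * ‖d‖ / (2 + ρ))), by positivity,
        min_le_left _ _, ?_, fun _ => ?_⟩
      · rw [← le_div_iff₀ (by positivity)]
        exact (min_le_right _ _).trans (min_le_left _ _)
      · set τ := min 1 (min (δ / (‖d‖ + 1)) (ρ * ‖d‖ / (2 + ρ)))
        have : τ ≤ ρ * ‖d‖ / (2 + ρ) := (min_le_right _ _).trans (min_le_right _ _)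
        rw [le_div_iff₀ (by positivity)] at this
        linarith
  refine ⟨τ, hτ0, fun t ht htτ w hw => ?_⟩
  have hw1 : ‖w‖ ≤ τ * t + t * ‖d‖ := by
    calc ‖w‖ = ‖(w - t • d) + t • d‖ := by rw [sub_add_cancel]
      _ ≤ _ := norm_add_le _ _
      _ ≤ _ := by rw [norm_smul, Real.norm_of_nonneg ht.le]; gcongr
  have hw2 : t * ‖d‖ ≤ ‖w‖ + τ * t := by
    calc t * ‖d‖ = ‖t • d‖ := by rw [norm_smul, Real.norm_of_nonneg ht.le]
      _ = ‖w - (w - t • d)‖ := by rw [sub_sub_cancel]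
      _ ≤ ‖w‖ + ‖w - t • d‖ := norm_sub_le _ _
      _ ≤ _ := by gcongr
  constructor
  · nlinarith [norm_nonneg d]
  · rcases eq_or_ne d 0 with rfl | hd
    · simp
    · have hd0 := norm_pos_iff.mpr hd
      have h1 : ‖‖d‖ • w - ‖w‖ • d‖ ≤ 2 * τ * t * ‖d‖ := by
        calc ‖‖d‖ • w - ‖w‖ • d‖ = ‖‖d‖ • (w - t • d) + (t * ‖d‖ - ‖w‖) • d‖ := by
              congr 1
              module
          _ ≤ ‖‖d‖ • (w - t • d)‖ + ‖(t * ‖d‖ - ‖w‖) • d‖ := norm_add_le _ _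
          _ = ‖d‖ * ‖w - t • d‖ + |t * ‖d‖ - ‖w‖| * ‖d‖ := by
              rw [norm_smul, norm_smul, norm_norm, Real.norm_eq_abs]
          _ ≤ ‖d‖ * (τ * t) + (τ * t) * ‖d‖ := by
              gcongr
              rw [abs_le]
              constructor <;> linarith
          _ = 2 * τ * t * ‖d‖ := by ring
      have h2 : 2 * τ * t ≤ ρ * ‖w‖ := by
        calc 2 * τ * t ≤ ρ * (‖d‖ - τ) * t := mul_le_mul_of_nonneg_right (hτ3 hd) ht.le
          _ = ρ * (t * ‖d‖ - τ * t) := by ring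
          _ ≤ ρ * ‖w‖ := by gcongr; linarith
      exact h1.trans (by gcongr)

/-! ### Projections and approximate translation invariance of a closed set. -/

theorem exists_sub_mem_frechetNormalCone {Y : Type*} [NormedAddCommGroup Y]
    [InnerProductSpace ℝ Y] [FiniteDimensional ℝ Y] {K : Set Y} (hK : IsClosed K)
    (hne : K.Nonempty) (q : Y) :
    ∃ p ∈ K, Metric.infDist q K = ‖q - p‖ ∧ q - p ∈ frechetNormalCone K p := by
  obtain ⟨p, hp, h⟩ := hK.exists_infDist_eq_dist hne q
  rw [dist_eq_norm] at h
  exact ⟨p, hp, h, sub_mem_frechetNormalCone_of_infDist_eq hp h⟩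

/-- A closed set is asymptotically invariant under translations along the polar of its directional
normal cone, at points near the base point in the given direction. -/
theorem exists_mem_near_translate {Y : Type*} [NormedAddCommGroup Y]
    [InnerProductSpace ℝ Y] [FiniteDimensional ℝ Y] {K : Set Y} (hK : IsClosed K) {y v z : Y}
    (hz : ∀ η ∈ dirNormalCone K y v, inner ℝ η z ≤ 0) {ε : ℝ} (hε : 0 < ε) :
    ∃ θ : ℝ, 0 < θ ∧ ∀ t, 0 < t → t ≤ θ → ∀ p ∈ K, ‖p - y - t • v‖ ≤ θ * t →
      ∀ s, 0 < s → s ≤ θ * t → ∃ p' ∈ K, ‖p' - p - s • z‖ ≤ ε * s := by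
  obtain ⟨θ₀, hθ₀, hN⟩ := exists_forall_frechetNormalCone_lt (K := K) (y := y) (v := v)
    (F := fun η => ε / 8 - inner ℝ η z) (by fun_prop)
    (fun η hη _ => by have := hz η hη; linarith)
  -- Projecting `p + a z` onto `K` moves at most `2 a ‖z‖ ≤ 2 θ t ‖z‖` away from `p`, so the
  -- projection stays in the tube of size `θ₀`.
  refine ⟨θ₀ / (1 + 2 * ‖z‖), by positivity, fun t ht htθ p hpK hp s hs hsθ => ?_⟩
  set θ := θ₀ / (1 + 2 * ‖z‖) with hθ
  have hθθ : θ * (1 + 2 * ‖z‖) = θ₀ := by rw [hθ]; field_simp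
  have hθle : θ ≤ θ₀ := div_le_self hθ₀.le (by linarith [norm_nonneg z])
  have hne : K.Nonempty := ⟨p, hpK⟩
  -- Continuous induction on `σ`: the distance to `K` grows at rate at most `ε / 2`. The extra `s`
  -- is a slack for points that are too close to `K`.
  set S : Set ℝ := {σ | Metric.infDist (p + σ • z) K ≤ ε / 2 * (σ + s)} with hS
  have hclosed : IsClosed S := by
    refine isClosed_le ((Metric.continuous_infDist_pt K).comp (by fun_prop)) (by fun_prop)
  have hsub : Icc 0 s ⊆ S := by
    refine (hclosed.inter isClosed_Icc).Icc_subset_of_forall_exists_gt ?_ ?_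
    · simp only [hS, mem_ofPred_eq, zero_smul, add_zero, Metric.infDist_zero_of_mem hpK]
      positivity
    · rintro a ⟨haS, ha0, has⟩ b (hab : a < b)
      obtain ⟨p', hp'K, hdist, hnormal⟩ := exists_sub_mem_frechetNormalCone hK hne (p + a • z)
      set r := p + a • z - p' with hr
      have hra : ‖r‖ ≤ a * ‖z‖ := by
        rw [← hdist]
        refine (Metric.infDist_le_dist_of_mem hpK).trans ?_
        rw [dist_eq_norm, add_sub_cancel_left, norm_smul, Real.norm_of_nonneg ha0]
      have hnext : ∀ h, 0 < h → h ≤ b - a → ‖r + h • z‖ ≤ ε / 2 * (a + h + s) →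
          (S ∩ Ioc a b).Nonempty := by
        intro h hh hhb hle
        refine ⟨a + h, ?_, by linarith, by linarith⟩
        refine (Metric.infDist_le_dist_of_mem hp'K).trans ?_
        rw [dist_eq_norm]
        refine le_trans (le_of_eq ?_) hle
        congr 1
        rw [hr]
        module
      -- Away from `K`, the residual `r` is normal at the projection, so `⟨r, z⟩ ≤ (ε / 8) ‖r‖` and
      -- the distance grows slowly over a short step. Close to `K`, the slack absorbs a short step
      -- without any normal.
      rcases le_or_gt (ε * s / 4) ‖r‖ with hlarge | hsmall
      · have hr0 : 0 < ‖r‖ := lt_of_lt_of_le (by positivity) hlarge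
        have hnear : ‖p' - y - t • v‖ ≤ θ₀ * t := by
          calc ‖p' - y - t • v‖ = ‖(p - y - t • v) + a • z - r‖ := by
                congr 1
                rw [hr]
                abel
            _ ≤ ‖p - y - t • v‖ + ‖a • z‖ + ‖r‖ :=
                (norm_sub_le _ _).trans (by gcongr; exact norm_add_le _ _)
            _ ≤ θ * t + a * ‖z‖ + a * ‖z‖ := by
                rw [norm_smul, Real.norm_of_nonneg ha0]
                gcongr
            _ ≤ θ * t + θ * t * ‖z‖ + θ * t * ‖z‖ := by
                gcongr <;> linarith
            _ = θ₀ * t := by rw [← hθθ]; ring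
        have hin : inner ℝ r z ≤ ε / 8 * ‖r‖ := by
          have h1 := hN t ht (htθ.trans hθle) p' hnear (‖r‖⁻¹ • r)
            (smul_mem_frechetNormalCone hnormal (by positivity))
            (by rw [norm_smul, norm_inv, norm_norm, inv_mul_cancel₀ hr0.ne'])
          rw [real_inner_smul_left] at h1
          have h2 : ‖r‖⁻¹ * inner ℝ r z ≤ ε / 8 := by linarith
          rwa [inv_mul_le_iff₀ hr0, mul_comm] at h2
        set h := min (b - a) (ε ^ 2 * s / (8 * (‖z‖ ^ 2 + 1))) with hh
        have hh0 : 0 < h := lt_min (by linarith) (by positivity)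
        have hh1 : h * ‖z‖ ^ 2 ≤ ε * ‖r‖ / 2 := by
          have h1 : h * (8 * (‖z‖ ^ 2 + 1)) ≤ ε ^ 2 * s :=
            (le_div_iff₀ (by positivity)).mp (min_le_right _ _)
          nlinarith
        refine hnext h hh0 (min_le_left _ _) ?_
        have h2 : ‖r + h • z‖ ≤ ‖r‖ + ε / 2 * h := by
          refine abs_le_of_sq_le_sq' ?_ (by positivity) |>.2
          rw [norm_add_sq_real, real_inner_smul_right, norm_smul, Real.norm_of_nonneg hh0.le]
          nlinarith [mul_le_mul_of_nonneg_left hin hh0.le, mul_le_mul_of_nonneg_left hh1 hh0.le,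
            sq_nonneg (ε / 2 * h), mul_pos hε (mul_pos hh0 hr0)]
        have h3 : ‖r‖ ≤ ε / 2 * (a + s) := by rw [← hdist]; exact haS
        linarith
      · set h := min (b - a) (ε * s / (4 * (‖z‖ + 1))) with hh
        have hh0 : 0 < h := lt_min (by linarith) (by positivity)
        have hh1 : h * ‖z‖ ≤ ε * s / 4 := by
          have h1 : h * (4 * (‖z‖ + 1)) ≤ ε * s :=
            (le_div_iff₀ (by positivity)).mp (min_le_right _ _)
          linarith
        refine hnext h hh0 (min_le_left _ _) ?_
        calc ‖r + h • z‖ ≤ ‖r‖ + h * ‖z‖ := by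
              refine (norm_add_le _ _).trans ?_
              rw [norm_smul, Real.norm_of_nonneg hh0.le]
          _ ≤ ε / 2 * s := by linarith
          _ ≤ ε / 2 * (a + h + s) := by gcongr; linarith
  have hsS : Metric.infDist (p + s • z) K ≤ ε / 2 * (s + s) := hsub ⟨hs.le, le_rfl⟩
  obtain ⟨p', hp'K, hdist, -⟩ := exists_sub_mem_frechetNormalCone hK hne (p + s • z)
  refine ⟨p', hp'K, ?_⟩
  rw [sub_sub, ← norm_neg, neg_sub, ← hdist]
  linarith

/-! ### Directional metric regularity. -/

theorem hasFDerivAt_norm_sub {E Y : Type*} [NormedAddCommGroup E] [NormedSpace ℝ E]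
    [NormedAddCommGroup Y] [InnerProductSpace ℝ Y] {g : E → Y} {A : E →L[ℝ] Y} {x : E}
    (hg : HasFDerivAt g A x) {p : Y} (hp : g x - p ≠ 0) :
    HasFDerivAt (fun x' => ‖g x' - p‖) (innerSL ℝ (‖g x - p‖⁻¹ • (g x - p)) ∘L A) x := by
  have h1 := ((hg.sub_const p).norm_sq).sqrt (by simpa using hp)
  simp only [Real.sqrt_sq (norm_nonneg _)] at h1
  refine h1.congr_fderiv ?_
  ext k
  simp only [smul_apply, ContinuousLinearMap.comp_apply, innerSL_apply_apply,
    real_inner_smul_left, smul_eq_mul, nsmul_eq_mul]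
  field_simp
  simp

/-- Directional metric regularity of the constraint `g x ∈ K`. -/
theorem exists_preimage_near {E Y : Type*} [NormedAddCommGroup E] [InnerProductSpace ℝ E]
    [FiniteDimensional ℝ E] [NormedAddCommGroup Y] [InnerProductSpace ℝ Y]
    [FiniteDimensional ℝ Y] {g : E → Y} (hg : ContDiff ℝ 1 g) {K : Set Y} (hK : IsClosed K)
    {x d : E}
    (hreg : ∀ η ∈ dirNormalCone K (g x) (fderiv ℝ g x d),
      ContinuousLinearMap.adjoint (fderiv ℝ g x) η = 0 → η = 0) :
    ∃ θ κ : ℝ, 0 < θ ∧ 0 < κ ∧ ∀ t, 0 < t → t ≤ θ → ∀ q, ‖q - x - t • d‖ ≤ θ * t →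
      ∀ p ∈ K, ‖g q - p‖ ≤ θ * t → ∃ x', g x' ∈ K ∧ ‖x' - q‖ ≤ κ * ‖g q - p‖ := by
  have hdiff : Differentiable ℝ g := hg.differentiable (by norm_num)
  set A := fderiv ℝ g x with hA
  obtain ⟨θ₀, hθ₀, hN⟩ := exists_forall_frechetNormalCone_lt (K := K) (y := g x) (v := A d)
    (F := fun η => ‖ContinuousLinearMap.adjoint A η‖) (by fun_prop) (fun η hη h1 => by
      rw [norm_pos_iff]
      intro h0
      rw [hreg η hη h0, norm_zero] at h1
      exact zero_ne_one h1)
  obtain ⟨τ, hτ, hnear⟩ := exists_forall_near_image (hdiff x).hasFDerivAt d (half_pos hθ₀)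
  have hcont : ∀ᶠ x' in 𝓝 x, ‖fderiv ℝ g x' - A‖ < θ₀ / 4 := by
    have h1 : Tendsto (fun x' => ‖fderiv ℝ g x' - A‖) (𝓝 x) (𝓝 ‖A - A‖) :=
      (((hg.continuous_fderiv (by norm_num)).tendsto x).sub_const A).norm
    rw [sub_self, norm_zero] at h1
    exact h1.eventually_lt_const (by positivity)
  obtain ⟨r, hr, hball⟩ := Metric.eventually_nhds_iff.mp hcont
  set ε : ℝ := θ₀ / 8 with hε
  have hε0 : 0 < ε := by positivity
  obtain ⟨θ, hθ, hθ1, hθ2, hθ3, hθ4⟩ : ∃ θ : ℝ, 0 < θ ∧ θ ≤ τ ∧ θ ≤ θ₀ / 2 ∧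
      θ * (1 + 1 / ε) ≤ τ ∧ θ * (τ + ‖d‖) < r := by
    refine ⟨min τ (min (θ₀ / 2) (min (τ / (1 + 1 / ε)) (r / (2 * (τ + ‖d‖ + 1))))),
      by positivity, min_le_left _ _, (min_le_right _ _).trans (min_le_left _ _), ?_, ?_⟩
    · rw [← le_div_iff₀ (by positivity)]
      exact (min_le_right _ _).trans ((min_le_right _ _).trans (min_le_left _ _))
    · set θ := min τ (min (θ₀ / 2) (min (τ / (1 + 1 / ε)) (r / (2 * (τ + ‖d‖ + 1)))))
      have hθ : 0 < θ := by positivity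
      have h1 : θ ≤ r / (2 * (τ + ‖d‖ + 1)) :=
        (min_le_right _ _).trans ((min_le_right _ _).trans (min_le_right _ _))
      rw [le_div_iff₀ (by positivity)] at h1
      nlinarith [norm_nonneg d]
  refine ⟨θ, 1 / ε, hθ, by positivity, fun t ht htθ q hq p hpK hp => ?_⟩
  rcases eq_or_ne (g q) p with heq | hneq
  · exact ⟨q, heq ▸ hpK, by simp [heq]⟩
  have hne : K.Nonempty := ⟨p, hpK⟩
  set δ := ‖g q - p‖ with hδ
  have hδ0 : 0 < δ := norm_pos_iff.mpr (sub_ne_zero.mpr hneq)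
  -- With this weight the minimizer lies within `δ / ε` of `q`, strictly inside the ball of radius
  -- `2 δ / ε`, and the quadratic term has gradient at most `2 ε = θ₀ / 4`.
  set c := ε ^ 2 / δ with hc
  have hc0 : 0 < c := by positivity
  have hcontinuous : Continuous fun x' => Metric.infDist (g x') K + c * ‖x' - q‖ ^ 2 :=
    ((Metric.continuous_infDist_pt K).comp hg.continuous).add (by fun_prop)
  obtain ⟨a, ha, hamin⟩ := (isCompact_closedBall q (2 * (δ / ε))).exists_isMinOn
    ⟨q, Metric.mem_closedBall_self (by positivity)⟩ hcontinuous.continuousOn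
  have hval : Metric.infDist (g a) K + c * ‖a - q‖ ^ 2 ≤ δ := by
    have h1 := hamin (Metric.mem_closedBall_self (by positivity : 0 ≤ 2 * (δ / ε)))
    have h2 : Metric.infDist (g q) K ≤ δ := by
      rw [hδ, ← dist_eq_norm]
      exact Metric.infDist_le_dist_of_mem hpK
    have h3 : Metric.infDist (g a) K + c * ‖a - q‖ ^ 2 ≤
      Metric.infDist (g q) K + c * ‖q - q‖ ^ 2 := h1
    simp only [sub_self, norm_zero] at h3
    linarith
  have hinf : 0 ≤ Metric.infDist (g a) K := Metric.infDist_nonneg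
  have haq : ‖a - q‖ ≤ δ / ε := by
    refine abs_le_of_sq_le_sq' ?_ (by positivity) |>.2
    have h1 : c * ‖a - q‖ ^ 2 ≤ δ := by linarith
    have h2 : c * (δ / ε) ^ 2 = δ := by rw [hc]; field_simp
    exact le_of_mul_le_mul_left (h1.trans h2.ge) hc0
  obtain ⟨p', hp'K, hdist, hnormal⟩ := exists_sub_mem_frechetNormalCone hK hne (g a)
  by_cases hzero : g a - p' = 0
  · refine ⟨a, by rwa [sub_eq_zero.mp hzero], ?_⟩
    rw [one_div_mul_eq_div]
    exact haq
  exfalso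
  have hlocmin : IsLocalMin (fun x' => ‖g x' - p'‖ + c * ‖x' - q‖ ^ 2) a := by
    have hnhds : Metric.closedBall q (2 * (δ / ε)) ∈ 𝓝 a := by
      refine Metric.closedBall_mem_nhds_of_mem ?_
      rw [Metric.mem_ball, dist_eq_norm]
      have : 0 < δ / ε := by positivity
      linarith
    filter_upwards [hnhds] with b hb
    rw [← hdist]
    refine (hamin hb).trans ?_
    have : Metric.infDist (g b) K ≤ ‖g b - p'‖ := by
      rw [← dist_eq_norm]
      exact Metric.infDist_le_dist_of_mem hp'K
    show Metric.infDist (g b) K + c * ‖b - q‖ ^ 2 ≤ _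
    linarith
  -- If `g a ∉ K`, stationarity tested on `h = A* η` forces `‖h‖ ≤ θ₀ / 2`: `θ₀ / 4` from the
  -- quadratic term and `θ₀ / 4` from replacing `fderiv ℝ g a` by `A`. This contradicts `θ₀ < ‖h‖`.
  have hstat := hlocmin.hasFDerivAt_eq_zero
    ((hasFDerivAt_norm_sub (hdiff a).hasFDerivAt hzero).add
      ((((hasFDerivAt_id a).sub_const q).norm_sq).const_mul c))
  have hρ0 : 0 < ‖g a - p'‖ := norm_pos_iff.mpr hzero
  set η := ‖g a - p'‖⁻¹ • (g a - p') with hη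
  have hη1 : ‖η‖ = 1 := by rw [hη, norm_smul, norm_inv, norm_norm, inv_mul_cancel₀ hρ0.ne']
  set h := ContinuousLinearMap.adjoint A η with hh
  have hst : inner ℝ η (fderiv ℝ g a h) + c * (2 * inner ℝ (a - q) h) = 0 := by
    have := congrArg (fun T : E →L[ℝ] ℝ => T h) hstat
    simpa only [add_apply, smul_apply, ContinuousLinearMap.comp_apply, innerSL_apply_apply,
      zero_apply, smul_eq_mul, nsmul_eq_mul, ContinuousLinearMap.id_apply, id_eq,
      Nat.cast_ofNat] using this
  have hδt : δ / ε ≤ θ * t * (1 / ε) := by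
    rw [mul_one_div]
    gcongr
  have hax : ‖a - x - t • d‖ ≤ τ * t := by
    calc ‖a - x - t • d‖ = ‖(q - x - t • d) + (a - q)‖ := by congr 1; abel
      _ ≤ _ := norm_add_le _ _
      _ ≤ θ * t + θ * t * (1 / ε) := add_le_add hq (haq.trans hδt)
      _ = θ * (1 + 1 / ε) * t := by ring
      _ ≤ τ * t := by gcongr
  have hp'near : ‖p' - g x - t • A d‖ ≤ θ₀ * t := by
    calc ‖p' - g x - t • A d‖ = ‖(g a - g x - t • A d) - (g a - p')‖ := by congr 1; abel
      _ ≤ _ := norm_sub_le _ _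
      _ ≤ θ₀ / 2 * t + θ₀ / 2 * t := by
        refine add_le_add (hnear t ht (htθ.trans hθ1) a hax) ?_
        rw [← hdist]
        have h1 : c * ‖a - q‖ ^ 2 ≥ 0 := by positivity
        calc Metric.infDist (g a) K ≤ δ := by linarith
          _ ≤ θ * t := hp
          _ ≤ θ₀ / 2 * t := by gcongr
      _ = θ₀ * t := by ring
  have hlower : θ₀ < ‖h‖ := hN t ht (by linarith) p' hp'near η
    (smul_mem_frechetNormalCone hnormal (by positivity)) hη1
  have hclose : ‖fderiv ℝ g a - A‖ < θ₀ / 4 := by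
    refine hball ?_
    rw [dist_eq_norm]
    calc ‖a - x‖ = ‖(a - x - t • d) + t • d‖ := by rw [sub_add_cancel]
      _ ≤ τ * t + t * ‖d‖ := by
        refine (norm_add_le _ _).trans ?_
        rw [norm_smul, Real.norm_of_nonneg ht.le]
        gcongr
      _ = t * (τ + ‖d‖) := by ring
      _ ≤ θ * (τ + ‖d‖) := by gcongr
      _ < r := hθ4
  have e1 : inner ℝ η (A h) = ‖h‖ ^ 2 := by
    rw [← ContinuousLinearMap.adjoint_inner_left, real_inner_self_eq_norm_sq]
  have e2 : |inner ℝ η ((fderiv ℝ g a - A) h)| ≤ θ₀ / 4 * ‖h‖ := by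
    refine (abs_real_inner_le_norm _ _).trans ?_
    rw [hη1, one_mul]
    exact ((fderiv ℝ g a - A).le_opNorm h).trans (by gcongr)
  have e3 : |c * (2 * inner ℝ (a - q) h)| ≤ θ₀ / 4 * ‖h‖ := by
    rw [abs_mul, abs_mul, abs_of_pos hc0, abs_two]
    calc c * (2 * |inner ℝ (a - q) h|) ≤ c * (2 * (δ / ε * ‖h‖)) := by
          gcongr
          exact (abs_real_inner_le_norm _ _).trans (by gcongr)
      _ = 2 * ε * ‖h‖ := by rw [hc]; field_simp
      _ = θ₀ / 4 * ‖h‖ := by rw [hε]; ring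
  rw [sub_apply, inner_sub_right, e1] at e2
  rw [abs_le] at e2 e3
  nlinarith [e2.1, e3.1, e2.2, e3.2]

/-! ### Existence of a multiplier by penalization. -/

/-- A quadratic penalty argument: an almost optimal point of a constrained problem is close to an
approximate stationary point with a Fréchet normal as multiplier. -/
theorem exists_penalty_stationary {E Y : Type*} [NormedAddCommGroup E] [InnerProductSpace ℝ E]
    [FiniteDimensional ℝ E] [NormedAddCommGroup Y] [InnerProductSpace ℝ Y]
    [FiniteDimensional ℝ Y] {f : E → ℝ} {g : E → Y} (hf : Differentiable ℝ f)
    (hg : Differentiable ℝ g) {K : Set Y} (hK : IsClosed K) {x₀ : E} (hx₀ : g x₀ ∈ K)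
    {ρ c m τ : ℝ} (hρ : 0 < ρ) (hc : 0 < c) (hτ : 0 < τ)
    (hm : ∀ x', ‖x' - x₀‖ ≤ ρ → g x' ∈ K → m ≤ f x') (hlt : f x₀ - m < c * ρ ^ 2) :
    ∃ x' p η, ‖x' - x₀‖ < ρ ∧ ‖g x' - p‖ ≤ τ ∧ η ∈ frechetNormalCone K p ∧
      ∀ h, fderiv ℝ f x' h + inner ℝ η (fderiv ℝ g x' h) + 2 * c * inner ℝ (x' - x₀) h = 0 := by
  have hne : K.Nonempty := ⟨_, hx₀⟩
  have hdc : Continuous fun x' => Metric.infDist (g x') K :=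
    (Metric.continuous_infDist_pt K).comp hg.continuous
  have hfc := hf.continuous
  have hmin : ∀ j : ℕ, ∃ a ∈ Metric.closedBall x₀ ρ, ∀ b ∈ Metric.closedBall x₀ ρ,
      f a + (j + 1) * Metric.infDist (g a) K ^ 2 + c * ‖a - x₀‖ ^ 2 ≤
        f b + (j + 1) * Metric.infDist (g b) K ^ 2 + c * ‖b - x₀‖ ^ 2 := by
    intro j
    obtain ⟨a, ha, hamin⟩ := (isCompact_closedBall x₀ ρ).exists_isMinOn
      ⟨x₀, Metric.mem_closedBall_self hρ.le⟩
      (f := fun a => f a + ((j : ℝ) + 1) * Metric.infDist (g a) K ^ 2 + c * ‖a - x₀‖ ^ 2)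
      (by fun_prop)
    exact ⟨a, ha, fun b hb => hamin hb⟩
  choose a ha hamin using hmin
  have hval : ∀ j : ℕ,
      f (a j) + (j + 1) * Metric.infDist (g (a j)) K ^ 2 + c * ‖a j - x₀‖ ^ 2 ≤ f x₀ := by
    intro j
    simpa [Metric.infDist_zero_of_mem hx₀] using
      hamin j x₀ (Metric.mem_closedBall_self hρ.le)
  -- As the penalty grows, the minimizers cluster at a feasible `u` with `m + c ‖u - x₀‖² ≤ f x₀`;
  -- the gap hypothesis then puts `u` in the open ball.
  obtain ⟨j, hj1, hj2⟩ : ∃ j, ‖a j - x₀‖ < ρ ∧ Metric.infDist (g (a j)) K < τ := by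
    obtain ⟨u, hu, φ, hφ, hlim⟩ := (isCompact_closedBall x₀ ρ).tendsto_subseq ha
    obtain ⟨b₀, hb₀, hb₀min⟩ := (isCompact_closedBall x₀ ρ).exists_isMinOn
      ⟨x₀, Metric.mem_closedBall_self hρ.le⟩ hfc.continuousOn
    have hdlim : Tendsto (fun k => Metric.infDist (g (a (φ k))) K) atTop
      (𝓝 (Metric.infDist (g u) K)) := (hdc.tendsto u).comp hlim
    have hnlim : Tendsto (fun k => ‖a (φ k) - x₀‖) atTop (𝓝 ‖u - x₀‖) :=
      (hlim.sub_const x₀).norm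
    have hd0 : Metric.infDist (g u) K ^ 2 ≤ 0 := by
      have h1 : Tendsto (fun k => (f x₀ - f b₀) * (1 / (((φ k : ℕ) : ℝ) + 1))) atTop
          (𝓝 ((f x₀ - f b₀) * 0)) :=
        ((tendsto_one_div_add_atTop_nhds_zero_nat (𝕜 := ℝ)).comp hφ.tendsto_atTop).const_mul _
      rw [mul_zero] at h1
      refine le_of_tendsto_of_tendsto (hdlim.pow 2) h1 (Eventually.of_forall fun k => ?_)
      have h2 := hval (φ k)
      have h3 : f b₀ ≤ f (a (φ k)) := hb₀min (ha (φ k))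
      have h4 : 0 ≤ c * ‖a (φ k) - x₀‖ ^ 2 := by positivity
      show Metric.infDist (g (a (φ k))) K ^ 2 ≤ (f x₀ - f b₀) * (1 / ((φ k : ℝ) + 1))
      rw [mul_one_div, le_div_iff₀ (by positivity)]
      linarith
    have hd0' : Metric.infDist (g u) K = 0 := pow_eq_zero_iff two_ne_zero |>.mp
      (le_antisymm hd0 (sq_nonneg _))
    have huK : g u ∈ K := (hK.mem_iff_infDist_zero hne).mpr hd0'
    have hfu : f u + c * ‖u - x₀‖ ^ 2 ≤ f x₀ := by
      refine le_of_tendsto (((hfc.tendsto u).comp hlim).add ((hnlim.pow 2).const_mul c))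
        (Eventually.of_forall fun k => ?_)
      have h2 := hval (φ k)
      have h4 : 0 ≤ ((φ k : ℝ) + 1) * Metric.infDist (g (a (φ k))) K ^ 2 := by positivity
      show f (a (φ k)) + c * ‖a (φ k) - x₀‖ ^ 2 ≤ _
      linarith
    have hmu := hm u (by simpa [dist_eq_norm] using hu) huK
    have hlt' : ‖u - x₀‖ < ρ := by
      refine lt_of_pow_lt_pow_left₀ 2 hρ.le ?_
      exact lt_of_mul_lt_mul_left (by linarith) hc.le
    obtain ⟨k, hk1, hk2⟩ := ((hnlim.eventually_lt_const hlt').and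
      (hdlim.eventually_lt_const (hd0'.trans_lt hτ))).exists
    exact ⟨φ k, hk1, hk2⟩
  obtain ⟨p, hpK, hdist, hnormal⟩ := exists_sub_mem_frechetNormalCone hK hne (g (a j))
  have hlocmin : IsLocalMin
      (fun b => f b + (j + 1) * ‖g b - p‖ ^ 2 + c * ‖b - x₀‖ ^ 2) (a j) := by
    have hnhds : Metric.closedBall x₀ ρ ∈ 𝓝 (a j) :=
      Metric.closedBall_mem_nhds_of_mem (by rwa [Metric.mem_ball, dist_eq_norm])
    filter_upwards [hnhds] with b hb
    rw [← hdist]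
    refine (hamin j b hb).trans ?_
    have h1 : Metric.infDist (g b) K ≤ ‖g b - p‖ := by
      rw [← dist_eq_norm]
      exact Metric.infDist_le_dist_of_mem hpK
    have h2 : 0 ≤ Metric.infDist (g b) K := Metric.infDist_nonneg
    gcongr
  have hstat := hlocmin.hasFDerivAt_eq_zero
    (((hf (a j)).hasFDerivAt.add
      ((((hg (a j)).hasFDerivAt.sub_const p).norm_sq).const_mul ((j : ℝ) + 1))).add
      ((((hasFDerivAt_id (a j)).sub_const x₀).norm_sq).const_mul c))
  refine ⟨a j, p, (2 * ((j : ℝ) + 1)) • (g (a j) - p), hj1, hdist ▸ hj2.le,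
    smul_mem_frechetNormalCone hnormal (by positivity), fun h => ?_⟩
  have h1 := congrArg (fun T : E →L[ℝ] ℝ => T h) hstat
  simp only [add_apply, smul_apply, ContinuousLinearMap.comp_apply, innerSL_apply_apply,
    zero_apply, smul_eq_mul, nsmul_eq_mul, ContinuousLinearMap.id_apply, id_eq] at h1
  rw [real_inner_smul_left]
  push_cast at h1
  linarith

theorem exists_approx_stationary {E Y : Type*} [NormedAddCommGroup E] [InnerProductSpace ℝ E]
    [FiniteDimensional ℝ E] [NormedAddCommGroup Y] [InnerProductSpace ℝ Y]
    [FiniteDimensional ℝ Y] {f : E → ℝ} {g : E → Y} (hf : Differentiable ℝ f)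
    (hg : Differentiable ℝ g) {K : Set Y} (hK : IsClosed K) {x d : E}
    (hd : d ∈ tangentCone (g ⁻¹' K) x) (hmin : IsDirLocalMin f (g ⁻¹' K) x d)
    (hfd : fderiv ℝ f x d = 0) {θ : ℝ} (hθ : 0 < θ) :
    ∃ t x' p η, 0 < t ∧ t ≤ θ ∧ ‖x' - x - t • d‖ ≤ θ * t ∧
      ‖p - g x - t • fderiv ℝ g x d‖ ≤ θ * t ∧ η ∈ frechetNormalCone K p ∧
      ∀ h, |fderiv ℝ f x' h + inner ℝ η (fderiv ℝ g x' h)| ≤ θ * ‖h‖ := by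
  obtain ⟨-, ρ, δ, hρ, hδ, hopt⟩ := hmin
  obtain ⟨τ₁, hτ₁, hnhd⟩ := exists_forall_mem_dirNhd hρ hδ d
  obtain ⟨τ₂, hτ₂, hgnear⟩ := exists_forall_near_image (hg x).hasFDerivAt d (half_pos hθ)
  obtain ⟨a, ha, ha0, ha1, ha2, ha3⟩ : ∃ a : ℝ, 0 < a ∧ a ≤ 1 ∧ 2 * a ≤ τ₁ ∧ 2 * a ≤ τ₂ ∧
      2 * a ≤ θ := by
    refine ⟨min 1 (min (τ₁ / 2) (min (τ₂ / 2) (θ / 2))), by positivity, min_le_left _ _, ?_⟩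
    set a := min 1 (min (τ₁ / 2) (min (τ₂ / 2) (θ / 2)))
    have h0 : a ≤ _ := min_le_right _ _
    have h1 := h0.trans (min_le_left _ _)
    have h2 := h0.trans (min_le_right _ _)
    have h3 := h2.trans (min_le_left _ _)
    have h4 := h2.trans (min_le_right _ _)
    refine ⟨by linarith, by linarith, by linarith⟩
  obtain ⟨τ₃, hτ₃, hfnear⟩ := exists_forall_near_image (hf x).hasFDerivAt d
    (show 0 < a ^ 3 / 2 by positivity)
  obtain ⟨t, e, ht, htlim, helim, hmem⟩ := hd
  have henorm : Tendsto (fun k => ‖e k - d‖) atTop (𝓝 0) :=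
    tendsto_iff_norm_sub_tendsto_zero.mp helim
  obtain ⟨k, hk1, hk2, hk3, hk4, hk5, hk6⟩ :=
    ((htlim.eventually_le_const hτ₁).and ((htlim.eventually_le_const hτ₂).and
      ((htlim.eventually_le_const hτ₃).and ((htlim.eventually_le_const hθ).and
        ((henorm.eventually_le_const ha).and (henorm.eventually_le_const hτ₃)))))).exists
  have htk := ht k
  have hek : ∀ c, ‖e k - d‖ ≤ c → ‖x + t k • e k - x - t k • d‖ ≤ c * t k := by
    intro c hc
    rw [add_sub_cancel_left, ← smul_sub, norm_smul, Real.norm_of_nonneg htk.le, mul_comm]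
    gcongr
  have hclose : ∀ x', ‖x' - (x + t k • e k)‖ ≤ a * t k → ‖x' - x - t k • d‖ ≤ 2 * a * t k := by
    intro x' hx'
    calc ‖x' - x - t k • d‖
        = ‖(x' - (x + t k • e k)) + (x + t k • e k - x - t k • d)‖ := by congr 1; abel
      _ ≤ a * t k + a * t k := (norm_add_le _ _).trans (add_le_add hx' (hek a hk5))
      _ = 2 * a * t k := by ring
  -- Radius `a t` and weight `a / t` balance two needs: the gap `c ρ² = a³ t` exceeds `f (x + t e) -
  -- f x`, which is `o(t)` since `∇f d = 0`, and the proximal residual `2 c ρ = 2 a²` is at most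
  -- `θ`.
  obtain ⟨x', p, η, hx', hp, hη, hst⟩ := exists_penalty_stationary hf hg hK (hmem k)
    (ρ := a * t k) (c := a / t k) (m := f x) (τ := θ / 2 * t k) (by positivity) (by positivity)
    (by positivity) (fun x' hx' hx'K => hopt x' hx'K
      (hnhd (t k) htk hk1 _ ((hclose x' hx').trans (by gcongr)))) (by
      have h1 := hfnear (t k) htk hk3 _ (hek τ₃ hk6)
      rw [hfd, smul_zero, sub_zero, Real.norm_eq_abs] at h1
      have h2 : a / t k * (a * t k) ^ 2 = a ^ 3 * t k := by field_simp
      rw [h2]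
      have h3 : 0 < a ^ 3 * t k := by positivity
      linarith [le_abs_self (f (x + t k • e k) - f x)])
  have hx'd := hclose x' hx'.le
  refine ⟨t k, x', p, η, htk, hk4, hx'd.trans (by gcongr), ?_, hη, fun h => ?_⟩
  · have h1 := hgnear (t k) htk hk2 x' (hx'd.trans (by gcongr))
    calc ‖p - g x - t k • fderiv ℝ g x d‖
        = ‖(g x' - g x - t k • fderiv ℝ g x d) - (g x' - p)‖ := by congr 1; abel
      _ ≤ θ / 2 * t k + θ / 2 * t k := (norm_sub_le _ _).trans (add_le_add h1 hp)
      _ = θ * t k := by ring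
  · have h1 : fderiv ℝ f x' h + inner ℝ η (fderiv ℝ g x' h) =
        -(2 * (a / t k) * inner ℝ (x' - (x + t k • e k)) h) := by linarith [hst h]
    rw [h1, abs_neg, abs_mul, abs_of_pos (by positivity)]
    calc 2 * (a / t k) * |inner ℝ (x' - (x + t k • e k)) h|
        ≤ 2 * (a / t k) * (a * t k * ‖h‖) := by
          gcongr
          exact (abs_real_inner_le_norm _ _).trans (by gcongr)
      _ = 2 * a * a * ‖h‖ := by field_simp
      _ ≤ θ * 1 * ‖h‖ := by gcongr
      _ = θ * ‖h‖ := by ring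

/-- Existence of an M-multiplier in direction `d` under the directional Mordukhovich criterion. -/
theorem exists_multiplier {E Y : Type*} [NormedAddCommGroup E] [InnerProductSpace ℝ E]
    [FiniteDimensional ℝ E] [NormedAddCommGroup Y] [InnerProductSpace ℝ Y]
    [FiniteDimensional ℝ Y] {f : E → ℝ} {g : E → Y} (hf : ContDiff ℝ 1 f)
    (hg : ContDiff ℝ 1 g) {K : Set Y} (hK : IsClosed K) {x d : E}
    (hd : d ∈ tangentCone (g ⁻¹' K) x) (hmin : IsDirLocalMin f (g ⁻¹' K) x d)
    (hfd : fderiv ℝ f x d = 0)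
    (hreg : ∀ η ∈ dirNormalCone K (g x) (fderiv ℝ g x d),
      ContinuousLinearMap.adjoint (fderiv ℝ g x) η = 0 → η = 0) :
    ∃ l ∈ dirNormalCone K (g x) (fderiv ℝ g x d),
      ∀ h, fderiv ℝ f x h + inner ℝ l (fderiv ℝ g x h) = 0 := by
  set A := fderiv ℝ g x with hA
  have hfdiff : Differentiable ℝ f := hf.differentiable (by norm_num)
  have hgdiff : Differentiable ℝ g := hg.differentiable (by norm_num)
  obtain ⟨θ₀, hθ₀, hN⟩ := exists_forall_frechetNormalCone_lt (K := K) (y := g x) (v := A d)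
    (F := fun η => ‖ContinuousLinearMap.adjoint A η‖) (by fun_prop) (fun η hη h1 => by
      rw [norm_pos_iff]
      intro h0
      rw [hreg η hη h0, norm_zero] at h1
      exact zero_ne_one h1)
  choose t a p η ht htθ ha hp hη hst using fun k : ℕ =>
    exists_approx_stationary hfdiff hgdiff hK hd hmin hfd
      (θ := 1 / ((k : ℝ) + 1)) Nat.one_div_pos_of_nat
  have hθ : Tendsto (fun k : ℕ => 1 / ((k : ℝ) + 1)) atTop (𝓝 0) :=
    tendsto_one_div_add_atTop_nhds_zero_nat
  have halim : Tendsto a atTop (𝓝 x) := by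
    rw [tendsto_iff_norm_sub_tendsto_zero]
    have h1 := hθ.mul (hθ.add_const ‖d‖)
    rw [zero_mul] at h1
    refine squeeze_zero (fun k => norm_nonneg _) (fun k => ?_) h1
    have htk := ht k
    calc ‖a k - x‖ = ‖(a k - x - t k • d) + t k • d‖ := by rw [sub_add_cancel]
      _ ≤ 1 / ((k : ℝ) + 1) * t k + t k * ‖d‖ := by
        refine (norm_add_le _ _).trans ?_
        rw [norm_smul, Real.norm_of_nonneg htk.le]
        gcongr
        exact ha k
      _ = t k * (1 / ((k : ℝ) + 1) + ‖d‖) := by ring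
      _ ≤ _ := by gcongr; exact htθ k
  have hf'lim : Tendsto (fun k => fderiv ℝ f (a k)) atTop (𝓝 (fderiv ℝ f x)) :=
    ((hf.continuous_fderiv (by norm_num)).tendsto x).comp halim
  have hg'lim : Tendsto (fun k => fderiv ℝ g (a k)) atTop (𝓝 A) :=
    ((hg.continuous_fderiv (by norm_num)).tendsto x).comp halim
  have hg'norm : Tendsto (fun k => ‖fderiv ℝ g (a k) - A‖) atTop (𝓝 0) :=
    tendsto_iff_norm_sub_tendsto_zero.mp hg'lim
  -- Testing approximate stationarity on `h = A* η` gives `θ₀ ‖η‖ ≤ ‖h‖ ≤ ‖∇f‖ + 2 + (θ₀ / 2) ‖η‖`.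
  have hbound : ∀ᶠ k in atTop, η k ∈ Metric.closedBall (0 : Y)
      (2 * (‖fderiv ℝ f x‖ + 2) / θ₀) := by
    filter_upwards [hθ.eventually_le_const hθ₀, hθ.eventually_le_const one_pos,
      hg'norm.eventually_le_const (half_pos hθ₀),
      hf'lim.norm.eventually_le_const (show ‖fderiv ℝ f x‖ < ‖fderiv ℝ f x‖ + 1 by linarith)]
      with k h1 h2 h3 h4
    rw [mem_closedBall_zero_iff, le_div_iff₀ hθ₀]
    set h := ContinuousLinearMap.adjoint A (η k) with hh
    have hlow : θ₀ * ‖η k‖ ≤ ‖h‖ := by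
      rcases eq_or_ne (η k) 0 with h0 | h0
      · simp [h0]
      · have h0' := norm_pos_iff.mpr h0
        have h5 := hN (t k) (ht k) ((htθ k).trans h1) (p k)
          ((hp k).trans (mul_le_mul_of_nonneg_right h1 (ht k).le)) (‖η k‖⁻¹ • η k)
          (smul_mem_frechetNormalCone (hη k) (by positivity))
          (by rw [norm_smul, norm_inv, norm_norm, inv_mul_cancel₀ h0'.ne'])
        rw [map_smul, norm_smul, norm_inv, norm_norm, lt_inv_mul_iff₀ h0', mul_comm] at h5
        exact h5.le
    have e1 : inner ℝ (η k) (A h) = ‖h‖ ^ 2 := by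
      rw [← ContinuousLinearMap.adjoint_inner_left, real_inner_self_eq_norm_sq]
    have e2 : |inner ℝ (η k) ((fderiv ℝ g (a k) - A) h)| ≤ ‖η k‖ * (θ₀ / 2 * ‖h‖) := by
      refine (abs_real_inner_le_norm _ _).trans ?_
      gcongr
      exact ((fderiv ℝ g (a k) - A).le_opNorm h).trans (by gcongr)
    have e3 : |fderiv ℝ f (a k) h| ≤ (‖fderiv ℝ f x‖ + 1) * ‖h‖ :=
      ((fderiv ℝ f (a k)).le_opNorm h).trans (by gcongr)
    have e4 : |fderiv ℝ f (a k) h + inner ℝ (η k) (fderiv ℝ g (a k) h)| ≤ 1 * ‖h‖ :=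
      (hst k h).trans (by gcongr)
    rw [sub_apply, inner_sub_right, e1] at e2
    have e5 : ‖h‖ * ‖h‖ ≤ (‖fderiv ℝ f x‖ + 2 + θ₀ / 2 * ‖η k‖) * ‖h‖ := by
      rw [abs_le] at e2 e3 e4
      nlinarith [e2.1, e3.1, e4.2]
    have e6 : ‖h‖ ≤ ‖fderiv ℝ f x‖ + 2 + θ₀ / 2 * ‖η k‖ := by
      rcases (norm_nonneg h).eq_or_lt with h0 | h0
      · rw [← h0]
        positivity
      · exact le_of_mul_le_mul_right e5 h0
    linarith
  obtain ⟨l, -, φ, hφ, hlim⟩ := tendsto_subseq_of_frequently_bounded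
    Metric.isBounded_closedBall hbound.frequently
  have hφ' := hφ.tendsto_atTop
  refine ⟨l, mem_dirNormalCone_of_seq (hθ.comp hφ') (fun k => ht (φ k)) (fun k => htθ (φ k))
    (fun k => hp (φ k)) hlim (fun k => hη (φ k)), fun h => ?_⟩
  have hleft : Tendsto (fun k => |fderiv ℝ f (a (φ k)) h +
      inner ℝ (η (φ k)) (fderiv ℝ g (a (φ k)) h)|) atTop
      (𝓝 |fderiv ℝ f x h + inner ℝ l (A h)|) :=
    ((((ContinuousLinearMap.apply ℝ ℝ h).continuous.tendsto _).comp (hf'lim.comp hφ')).add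
      (hlim.inner
        (((ContinuousLinearMap.apply ℝ Y h).continuous.tendsto _).comp (hg'lim.comp hφ')))).abs
  have hright := (hθ.comp hφ').mul_const ‖h‖
  rw [zero_mul] at hright
  exact abs_nonpos_iff.mp (le_of_tendsto_of_tendsto hleft hright
    (Eventually.of_forall fun k => hst (φ k) h))

/-! ### Second-order necessary conditions. -/

/-- The increment is `t e` with `e → d`, and the Taylor remainder `o(t²)` is `o(s)` because `t² / (2
s)` converges. Keeping `β` free covers both second-order scalings. -/
theorem tendsto_second_order_quotient {E G : Type*} [NormedAddCommGroup E] [NormedSpace ℝ E]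
    [NormedAddCommGroup G] [NormedSpace ℝ G] {F : E → G} (hF : ContDiff ℝ 2 F) (x d u : E)
    {t s : ℕ → ℝ} {β : ℝ} (ht : ∀ k, 0 < t k) (hs : ∀ k, 0 < s k)
    (htlim : Tendsto t atTop (𝓝 0)) (hst : Tendsto (fun k => s k / t k) atTop (𝓝 0))
    (hβ : Tendsto (fun k => t k ^ 2 / (2 * s k)) atTop (𝓝 β)) :
    Tendsto (fun k => (s k)⁻¹ • (F (x + (t k • d + s k • u)) - F x - t k • fderiv ℝ F x d)) atTop
      (𝓝 (fderiv ℝ F x u + β • fderiv ℝ (fderiv ℝ F) x d d)) := by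
  set B := fderiv ℝ (fderiv ℝ F) x with hB
  set e : ℕ → E := fun k => d + (s k / t k) • u with he
  have hte : ∀ k, t k • d + s k • u = t k • e k := by
    intro k
    rw [he, smul_add, smul_smul, mul_div_cancel₀ _ (ht k).ne']
  have helim : Tendsto e atTop (𝓝 d) := by
    have := (hst.smul_const u).const_add d
    rwa [zero_smul, add_zero] at this
  have hhlim : Tendsto (fun k => t k • e k) atTop (𝓝 0) := by
    have := htlim.smul helim
    rwa [zero_smul] at this
  have hO : (fun k => ‖t k • e k‖ ^ 2) =O[atTop] s := by
    refine Asymptotics.isBigO_of_div_tendsto_nhds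
      (Eventually.of_forall fun k h => absurd h (hs k).ne') (β * (2 * ‖d‖ ^ 2)) ?_
    refine (hβ.mul ((helim.norm.pow 2).const_mul 2)).congr fun k => ?_
    have := (hs k).ne'
    rw [Pi.div_apply, norm_smul, Real.norm_of_nonneg (ht k).le]
    field_simp
  have hR := (((taylor_two_isLittleO hF x).comp_tendsto hhlim).trans_isBigO
    hO).tendsto_inv_smul_nhds_zero
  have hB' : Tendsto (fun k => B (e k) (e k)) atTop (𝓝 (B d d)) :=
    ((show Continuous fun e => B e e by fun_prop).tendsto d).comp helim
  have hsum := ((hβ.smul hB').const_add (fderiv ℝ F x u)).add hR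
  rw [add_zero] at hsum
  refine hsum.congr fun k => ?_
  have hsk := (hs k).ne'
  simp only [Function.comp_apply, hte k, ← hB]
  have h1 : fderiv ℝ F x (t k • e k) = t k • fderiv ℝ F x d + s k • fderiv ℝ F x u := by
    rw [← hte k, map_add, map_smul, map_smul]
  rw [h1]
  simp only [map_smul, smul_apply]
  generalize fderiv ℝ F x u = U
  generalize B (e k) (e k) = V
  match_scalars <;> field_simp
  all_goals ring

/-- Second-order necessary condition along a parametrized second-order tangent. -/
theorem inner_le_of_second_order_tangent {E Y : Type*} [NormedAddCommGroup E]
    [InnerProductSpace ℝ E] [FiniteDimensional ℝ E] [NormedAddCommGroup Y]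
    [InnerProductSpace ℝ Y] [FiniteDimensional ℝ Y] {f : E → ℝ} {g : E → Y}
    (hf : ContDiff ℝ 2 f) (hg : ContDiff ℝ 2 g) {K : Set Y} (hK : IsClosed K) {x d : E}
    (hmin : IsDirLocalMin f (g ⁻¹' K) x d) (hfd : fderiv ℝ f x d = 0)
    (hnd : ∀ η, ContinuousLinearMap.adjoint (fderiv ℝ g x) η = 0 →
      η ∈ Submodule.span ℝ (dirNormalCone K (g x) (fderiv ℝ g x d)) → η = 0)
    {l : Y} (hl : l ∈ dirNormalCone K (g x) (fderiv ℝ g x d))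
    (hstat : ∀ h, fderiv ℝ f x h + inner ℝ l (fderiv ℝ g x h) = 0)
    {t s : ℕ → ℝ} {w' : ℕ → Y} {w : Y} {β : ℝ} (ht : ∀ k, 0 < t k) (hs : ∀ k, 0 < s k)
    (htlim : Tendsto t atTop (𝓝 0)) (hst : Tendsto (fun k => s k / t k) atTop (𝓝 0))
    (hβ : Tendsto (fun k => t k ^ 2 / (2 * s k)) atTop (𝓝 β)) (hw : Tendsto w' atTop (𝓝 w))
    (hmem : ∀ k, g x + t k • fderiv ℝ g x d + s k • w' k ∈ K) :
    inner ℝ l w ≤ β * fderiv ℝ (fderiv ℝ fun y => f y + inner ℝ l (g y)) x d d := by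
  set A := fderiv ℝ g x with hA
  set W := Submodule.span ℝ (dirNormalCone K (g x) (A d)) with hW
  set H := fderiv ℝ (fderiv ℝ fun y => f y + inner ℝ l (g y)) x d d with hH
  have hfdiff : Differentiable ℝ f := hf.differentiable (by norm_num)
  have hgdiff : Differentiable ℝ g := hg.differentiable (by norm_num)
  -- The orthogonal complement of this sum is `ker A* ∩ W`, which nondegeneracy makes trivial.
  have htop : A.range ⊔ Wᗮ = ⊤ := by
    rw [← Submodule.orthogonal_eq_bot_iff, ← Submodule.inf_orthogonal,
      Submodule.orthogonal_orthogonal, ContinuousLinearMap.orthogonal_range, Submodule.eq_bot_iff]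
    rintro η ⟨h1, h2⟩
    exact hnd η h1 h2
  obtain ⟨_, ⟨u, rfl⟩, z, hz, huz⟩ := Submodule.mem_sup.mp
    (htop ▸ Submodule.mem_top : w - β • fderiv ℝ (fderiv ℝ g) x d d ∈ A.range ⊔ Wᗮ)
  have huz' : A u + β • fderiv ℝ (fderiv ℝ g) x d d = w - z := by
    have h1 : A u + z = w - β • fderiv ℝ (fderiv ℝ g) x d d := huz
    rw [eq_sub_iff_add_eq, add_right_comm, h1, sub_add_cancel]
  have hzN : ∀ η ∈ dirNormalCone K (g x) (A d), inner ℝ η z = 0 := fun η hη =>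
    Submodule.inner_right_of_mem_orthogonal (Submodule.subset_span hη) hz
  set q : ℕ → E := fun k => x + (t k • d + s k • u) with hq
  have hL : ContDiff ℝ 2 fun y => f y + inner ℝ l (g y) := hf.add (contDiff_const.inner ℝ hg)
  have hL' : fderiv ℝ (fun y => f y + inner ℝ l (g y)) x = 0 := by
    have h1 := (hfdiff x).hasFDerivAt.add
      ((innerSL ℝ l).hasFDerivAt.comp x (hgdiff x).hasFDerivAt)
    refine Eq.trans (HasFDerivAt.fderiv h1) ?_
    ext h
    simpa using hstat h
  have hLlim := tendsto_second_order_quotient hL x d u ht hs htlim hst hβ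
  have hglim := tendsto_second_order_quotient hg x d u ht hs htlim hst hβ
  rw [hL'] at hLlim
  rw [huz'] at hglim
  have hAd : inner ℝ l (A d) = 0 := by
    have := hstat d
    rwa [hfd, zero_add] at this
  -- Subtract `⟨l, g⟩` from the Lagrangian expansion; the terms in `A d` and `z` vanish, the latter
  -- because `l` is itself a directional normal.
  have hflim : Tendsto (fun k => (f (q k) - f x) / s k) atTop (𝓝 (β * H - inner ℝ l w)) := by
    have h1 := hLlim.sub ((tendsto_const_nhds (x := l)).inner hglim)
    rw [inner_sub_right, hzN l hl, sub_zero] at h1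
    simp only [zero_apply, zero_add, smul_eq_mul] at h1
    refine h1.congr fun k => ?_
    simp only [sub_zero, real_inner_smul_right,
      inner_sub_right, ← hA, hAd, mul_zero]
    ring
  obtain ⟨θ₁, κ, hθ₁, hκ, hregular⟩ := exists_preimage_near (hg.of_le (by norm_num)) hK
    (x := x) (d := d) (fun η hη h0 => hnd η h0 (Submodule.subset_span hη))
  obtain ⟨-, ρ, δ, hρ, hδ, hopt⟩ := hmin
  obtain ⟨τ, hτ, hnhd⟩ := exists_forall_mem_dirNhd hρ hδ d
  obtain ⟨C, U, hU, hlip⟩ := (hf.contDiffAt (x := x)).of_le (by norm_num : (1 : WithTop ℕ∞) ≤ 2)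
    |>.exists_lipschitzOnWith
  obtain ⟨r, hr, hball⟩ := Metric.mem_nhds_iff.mp hU
  have hsmall : ∀ c θ : ℝ, 0 < θ → ∀ᶠ k in atTop, s k * c ≤ θ * t k := by
    intro c θ hθ
    have h1 := hst.mul_const c
    rw [zero_mul] at h1
    filter_upwards [h1.eventually_le_const hθ] with k hk
    rwa [div_mul_eq_mul_div, div_le_iff₀ (ht k)] at hk
  -- The `3 ε` collects the errors of the expansion of `g`, of `w' k - w`, and of the translation by
  -- `-z`. Metric regularity multiplies it by `κ`, and the Lipschitz constant of `f` by `C`.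
  have hε : ∀ ε : ℝ, 0 < ε → 0 ≤ β * H - inner ℝ l w + C * (κ * (3 * ε)) := by
    intro ε hε
    obtain ⟨θ₂, hθ₂, htranslate⟩ := exists_mem_near_translate hK (y := g x) (v := A d) (z := -z)
      (fun η hη => by rw [inner_neg_right, hzN η hη, neg_zero]) hε
    have hgε : ∀ᶠ k in atTop, ‖(s k)⁻¹ • (g (q k) - g x - t k • A d) - (w - z)‖ ≤ ε :=
      (tendsto_iff_norm_sub_tendsto_zero.mp hglim).eventually_le_const hε
    have hwε : ∀ᶠ k in atTop, ‖w' k - w‖ ≤ ε :=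
      (tendsto_iff_norm_sub_tendsto_zero.mp hw).eventually_le_const hε
    have htr : ∀ᶠ k in atTop, t k * (τ + ‖d‖) < r := by
      have h1 := htlim.mul_const (τ + ‖d‖)
      rw [zero_mul] at h1
      exact h1.eventually_lt_const hr
    refine ge_of_tendsto (hflim.add_const _) ?_
    filter_upwards [hgε, hwε, htr, htlim.eventually_le_const hθ₁, htlim.eventually_le_const hθ₂,
      htlim.eventually_le_const hτ, hsmall (‖w‖ + ε) θ₂ hθ₂, hsmall 1 θ₂ hθ₂, hsmall ‖u‖ θ₁ hθ₁,
      hsmall (3 * ε) θ₁ hθ₁, hsmall (‖u‖ + κ * (3 * ε)) τ hτ]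
      with k hgk hwk htr ht1 ht2 htτ hs1 hs2 hs3 hs4 hs5
    have htk := ht k
    have hsk := hs k
    have hw'norm : ‖w' k‖ ≤ ‖w‖ + ε := by
      calc ‖w' k‖ = ‖w + (w' k - w)‖ := by rw [add_sub_cancel]
        _ ≤ _ := (norm_add_le _ _).trans (by gcongr)
    obtain ⟨p, hpK, hp⟩ := htranslate (t k) htk ht2 _ (hmem k) (by
      rw [show g x + t k • A d + s k • w' k - g x - t k • A d = s k • w' k by abel, norm_smul,
        Real.norm_of_nonneg hsk.le]
      exact (mul_le_mul_of_nonneg_left hw'norm hsk.le).trans hs1) (s k) hsk (by linarith)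
    have hqd : q k - x - t k • d = s k • u := by
      simp only [hq]
      abel
    have hqd' : ‖q k - x - t k • d‖ = s k * ‖u‖ := by
      rw [hqd, norm_smul, Real.norm_of_nonneg hsk.le]
    have hres : ‖g (q k) - p‖ ≤ s k * (3 * ε) := by
      have h1 : g (q k) - p = s k • ((s k)⁻¹ • (g (q k) - g x - t k • A d) - (w - z)) -
          s k • (w' k - w) - (p - (g x + t k • A d + s k • w' k) - s k • (-z)) := by
        rw [smul_sub (s k) ((s k)⁻¹ • _), smul_smul, mul_inv_cancel₀ hsk.ne', one_smul]
        module
      rw [h1]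
      calc _ ≤ s k * ε + s k * ε + ε * s k := by
            refine (norm_sub_le _ _).trans (add_le_add ((norm_sub_le _ _).trans ?_) hp)
            rw [norm_smul, norm_smul, Real.norm_of_nonneg hsk.le]
            gcongr
        _ = s k * (3 * ε) := by ring
    obtain ⟨a, haK, ha⟩ := hregular (t k) htk ht1 (q k) (hqd'.le.trans hs3) p hpK
      (hres.trans hs4)
    have haq : ‖a - q k‖ ≤ s k * (κ * (3 * ε)) := by
      calc _ ≤ κ * (s k * (3 * ε)) := ha.trans (by gcongr)
        _ = _ := by ring
    have had : ‖a - x - t k • d‖ ≤ τ * t k := by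
      calc ‖a - x - t k • d‖ = ‖(q k - x - t k • d) + (a - q k)‖ := by congr 1; abel
        _ ≤ s k * ‖u‖ + s k * (κ * (3 * ε)) := (norm_add_le _ _).trans (add_le_add hqd'.le haq)
        _ = s k * (‖u‖ + κ * (3 * ε)) := by ring
        _ ≤ τ * t k := hs5
    have hqτ : ‖q k - x - t k • d‖ ≤ τ * t k := by
      rw [hqd']
      refine le_trans ?_ hs5
      gcongr
      have : 0 ≤ κ * (3 * ε) := by positivity
      linarith
    have hinU : ∀ b, ‖b - x - t k • d‖ ≤ τ * t k → b ∈ U := by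
      intro b hb
      refine hball ?_
      rw [Metric.mem_ball, dist_eq_norm]
      calc ‖b - x‖ = ‖(b - x - t k • d) + t k • d‖ := by rw [sub_add_cancel]
        _ ≤ τ * t k + t k * ‖d‖ := by
          refine (norm_add_le _ _).trans ?_
          rw [norm_smul, Real.norm_of_nonneg htk.le]
          gcongr
        _ = t k * (τ + ‖d‖) := by ring
        _ < r := htr
    have hfa : f x ≤ f a := hopt a haK (hnhd (t k) htk htτ _ had)
    have hfq : f a - f (q k) ≤ C * (s k * (κ * (3 * ε))) := by
      have h1 := hlip.dist_le_mul a (hinU a had) (q k) (hinU _ hqτ)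
      rw [Real.dist_eq, dist_eq_norm] at h1
      exact (le_abs_self _).trans (h1.trans (by gcongr))
    have h2 : 0 ≤ (f (q k) - f x + C * (s k * (κ * (3 * ε)))) / s k :=
      div_nonneg (by linarith) hsk.le
    refine h2.trans_eq ?_
    field_simp
  rw [← sub_nonneg]
  refine le_of_forall_pos_le_add fun e he => ?_
  have h1 := hε (e / (3 * κ * (C + 1))) (by positivity)
  refine h1.trans (add_le_add le_rfl ?_)
  have h2 : (C : ℝ) * (κ * (3 * (e / (3 * κ * (C + 1))))) = C / (C + 1) * e := by field_simp
  rw [h2]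
  have h3 : (C : ℝ) / (C + 1) ≤ 1 := by
    rw [div_le_one (by positivity)]
    linarith
  calc C / (C + 1) * e ≤ 1 * e := by gcongr
    _ = e := one_mul e

/-! ### The multiplier set and the two support-function conditions. -/

theorem gradient_lagrangian_eq_zero_iff {n m : ℕ} {f : EuclideanSpace ℝ (Fin n) → ℝ}
    {g : EuclideanSpace ℝ (Fin n) → EuclideanSpace ℝ (Fin m)} (hf : Differentiable ℝ f)
    (hg : Differentiable ℝ g) (x : EuclideanSpace ℝ (Fin n)) (l : EuclideanSpace ℝ (Fin m)) :
    gradient (fun y => lagrangian f g y l) x = 0 ↔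
      ∀ h, fderiv ℝ f x h + inner ℝ l (fderiv ℝ g x h) = 0 := by
  have h1 : HasFDerivAt (fun y => lagrangian f g y l)
      (fderiv ℝ f x + innerSL ℝ l ∘L fderiv ℝ g x) x :=
    (hf x).hasFDerivAt.add ((innerSL ℝ l).hasFDerivAt.comp x (hg x).hasFDerivAt)
  rw [gradient, h1.fderiv, LinearIsometryEquiv.map_eq_zero_iff, ContinuousLinearMap.ext_iff]
  simp

end DirOpt

theorem corollary4p11 {n m : ℕ}
    (f : EuclideanSpace ℝ (Fin n) → ℝ)
    (g : EuclideanSpace ℝ (Fin n) → EuclideanSpace ℝ (Fin m))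
    (K : Set (EuclideanSpace ℝ (Fin m)))
    (hf : ContDiff ℝ 2 f) (hg : ContDiff ℝ 2 g) (hK : IsClosed K)
    (x d : EuclideanSpace ℝ (Fin n))
    (hd : d ∈ DirOpt.tangentCone (g ⁻¹' K) x)
    (hmin : DirOpt.IsDirLocalMin f (g ⁻¹' K) x d)
    (hfd : fderiv ℝ f x d = 0)
    (hnd : DirOpt.DirNondegenerate g K x d) :
    ∃ l : EuclideanSpace ℝ (Fin m),
      DirOpt.multiplierSet f g K x d = {l} ∧
      DirOpt.supportFn (DirOpt.asympSecondTangentCone K (g x) (fderiv ℝ g x d)) l ≤ 0 ∧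
      ((DirOpt.secondTangentSet K (g x) (fderiv ℝ g x d)).Nonempty →
        0 ≤ (DirOpt.lagrangianHess f g x l d : EReal) -
          DirOpt.supportFn (DirOpt.secondTangentSet K (g x) (fderiv ℝ g x d)) l) := by
  have hfdiff : Differentiable ℝ f := hf.differentiable (by norm_num)
  have hgdiff : Differentiable ℝ g := hg.differentiable (by norm_num)
  obtain ⟨l, hl, hstat⟩ := DirOpt.exists_multiplier (hf.of_le (by norm_num))
    (hg.of_le (by norm_num)) hK hd hmin hfd
    (fun η hη h0 => hnd η h0 (Submodule.subset_span hη))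
  refine ⟨l, ?_, ?_, fun _ => ?_⟩
  · ext l'
    simp only [DirOpt.multiplierSet, mem_ofPred_eq, mem_singleton_iff,
      DirOpt.gradient_lagrangian_eq_zero_iff hfdiff hgdiff]
    refine ⟨fun ⟨hl', hstat'⟩ => ?_, fun h => h ▸ ⟨hl, hstat⟩⟩
    rw [← sub_eq_zero]
    -- The difference of two multipliers lies in the span and in the kernel of the adjoint.
    refine hnd _ (ext_inner_right ℝ fun h => ?_)
      (sub_mem (Submodule.subset_span hl') (Submodule.subset_span hl))
    rw [ContinuousLinearMap.adjoint_inner_left, inner_sub_left, inner_zero_left]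
    linarith [hstat h, hstat' h]
  · refine iSup₂_le fun w hw => ?_
    obtain ⟨t, r, w', ht, hr, htlim, hrlim, htr, hwlim, hmem⟩ := hw
    -- Here `s = t r / 2`, so `t² / (2 s) = t / r → 0` and the Hessian term disappears.
    have h1 := DirOpt.inner_le_of_second_order_tangent hf hg hK hmin hfd hnd hl hstat
      (s := fun k => 1 / 2 * (t k * r k)) (β := 0) ht
      (fun k => by have := ht k; have := hr k; positivity) htlim
      (by
        have h2 := hrlim.const_mul (1 / 2)
        rw [mul_zero] at h2
        refine h2.congr fun k => ?_
        have := (ht k).ne'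
        field_simp)
      (htr.congr fun k => by
        have := (ht k).ne'
        have := (hr k).ne'
        field_simp) hwlim hmem
    rw [zero_mul] at h1
    exact_mod_cast h1
  · rw [EReal.sub_nonneg (Or.inl (EReal.coe_ne_top _)) (Or.inl (EReal.coe_ne_bot _))]
    refine iSup₂_le fun w hw => ?_
    obtain ⟨t, w', ht, htlim, hwlim, hmem⟩ := hw
    -- Here `s = t² / 2`, so `t² / (2 s) = 1` and the full Hessian term remains.
    have h1 := DirOpt.inner_le_of_second_order_tangent hf hg hK hmin hfd hnd hl hstat
      (s := fun k => 1 / 2 * t k ^ 2) (β := 1) ht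
      (fun k => by have := ht k; positivity) htlim
      (by
        have h2 := htlim.const_mul (1 / 2)
        rw [mul_zero] at h2
        refine h2.congr fun k => ?_
        have := (ht k).ne'
        field_simp)
      (tendsto_const_nhds.congr fun k => by
        have := (ht k).ne'
        field_simp) hwlim hmem
    rw [one_mul] at h1
    exact_mod_cast h1
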